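/- Theorem 4.8 (Regularity of Dominant Ideals). Let $k$ be a field, let $S$ be a polynomial ring over $k$ in finitely many variables with its standard grading, and let $M\subseteq S$ be a monomial ideal with minimal set of monomial generators $G=\{m_1,\ldots,m_q\}$. Suppose that $M$ is dominant, i.e. for every $m\in G$ there are a variable $x$ and a positive integer $e$ such that $x^e\mid m$ and $x^e\nmid m'$ for all $m'\in G\setminus\{m\}$. Let $h$ be the degree of $\operatorname{lcm}(m_1,\ldots,m_q)$. Then $$\operatorname{reg}(S/M)=h-q,$$ where $\operatorname{reg}(S/M)=\max\{\,j-i : b_{i,j}(S/M)\neq 0\,\}$ and $b_{i,j}(S/M)$ is the number of basis elements of degree $j$ in homological degree $i$ of a minimal graded free resolution of $S/M$. (For $M=0$ one has $q=0$ and $\operatorname{lcm}(\varnothing)=1$.) -/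

import Mathlib

namespace MonomialResolution

open MvPolynomial

universe u v

/-- The ideal of `k[x_s : s ∈ σ]` generated by the monomials `x^a`, `a ∈ G`.
A monomial is represented by its exponent vector `a : σ →₀ ℕ`. -/
noncomputable def monomialIdeal (k : Type u) {σ : Type v} [Field k] (G : Finset (σ →₀ ℕ)) :
    Ideal (MvPolynomial σ k) :=
  Ideal.span ((fun a : σ →₀ ℕ => monomial a (1 : k)) '' (G : Set (σ →₀ ℕ)))

/-- `G` is a minimal set of monomials generating the ideal `M`: it generates `M`, and no proper
subset of it does. -/
def IsMinimalGeneratingSet {k : Type u} {σ : Type v} [Field k]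
    (G : Finset (σ →₀ ℕ)) (M : Ideal (MvPolynomial σ k)) : Prop :=
  Minimal (fun G' : Finset (σ →₀ ℕ) => monomialIdeal k G' = M) G

/-- `x` is a dominant variable of the monomial `m` with respect to `G`: for some positive `e`,
`x ^ e` divides `m` and divides no other monomial of `G`. -/
def IsDominantVariable {σ : Type v} (G : Finset (σ →₀ ℕ)) (m : σ →₀ ℕ) (x : σ) : Prop :=
  ∃ e : ℕ, 0 < e ∧ e ≤ m x ∧ ∀ m' ∈ G, m' ≠ m → ¬ e ≤ m' x

/-- A set of monomials is dominant if each of its elements has a dominant variable. -/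
def IsDominantSet {σ : Type v} (G : Finset (σ →₀ ℕ)) : Prop :=
  ∀ m ∈ G, ∃ x : σ, IsDominantVariable G m x

/-- A dominant ideal: a monomial ideal whose minimal generating set is dominant. -/
def IsDominantIdeal {k : Type u} {σ : Type v} [Field k] (M : Ideal (MvPolynomial σ k)) : Prop :=
  ∃ G : Finset (σ →₀ ℕ), IsMinimalGeneratingSet G M ∧ IsDominantSet G

/-- `p` is zero or homogeneous of total degree `d`, where `d` may be any integer. -/
def IsHomogeneousOfDegree {k : Type u} {σ : Type v} [Field k]
    (p : MvPolynomial σ k) (d : ℤ) : Prop :=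
  ∀ a ∈ p.support, (a.degree : ℤ) = d

/-- A graded free resolution
`⋯ ⟶ F 2 ⟶ F 1 ⟶ F 0 ⟶ S ⧸ I ⟶ 0` of `S ⧸ I`, `S = k[x_s : s ∈ σ]` with its standard grading.
The module `F i` is the free module `ι i →₀ S` of finite rank, in which the basis element
indexed by `b : ι i` has degree `deg i b`; in other words, `F i = ⨁ b, S(-deg i b)`. -/
structure GradedFreeResolution {k : Type u} {σ : Type v} [Field k]
    (I : Ideal (MvPolynomial σ k)) where
  /-- the index set of the homogeneous basis in homological degree `i` -/
  ι : ℕ → Type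
  finite_ι : ∀ i, Finite (ι i)
  /-- the degrees of the basis elements -/
  deg : ∀ i, ι i → ℤ
  /-- the differentials -/
  d : ∀ i, (ι (i + 1) →₀ MvPolynomial σ k) →ₗ[MvPolynomial σ k] (ι i →₀ MvPolynomial σ k)
  /-- the augmentation -/
  ε : (ι 0 →₀ MvPolynomial σ k) →ₗ[MvPolynomial σ k] (MvPolynomial σ k ⧸ I)
  /-- the differentials are graded of degree `0`: the entry of the matrix of `d i` in the column
  of `b` and the row of `c` is homogeneous of degree `deg b - deg c` -/
  d_homogeneous : ∀ i (b : ι (i + 1)) (c : ι i),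
    IsHomogeneousOfDegree (d i (Finsupp.single b 1) c) (deg (i + 1) b - deg i c)
  /-- the augmentation is graded of degree `0` -/
  ε_homogeneous : ∀ b : ι 0, ∃ p : MvPolynomial σ k,
    IsHomogeneousOfDegree p (deg 0 b) ∧ ε (Finsupp.single b 1) = Ideal.Quotient.mk I p
  exact_succ : ∀ i, Function.Exact (d (i + 1)) (d i)
  exact_zero : Function.Exact (d 0) ε
  surjective : Function.Surjective ε

/-- The resolution is minimal: `d (F (i + 1)) ⊆ 𝔪 F i` with `𝔪` the ideal of the variables, i.e.
all entries of the matrices of the differentials lie in `𝔪` (have constant term zero). -/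
def GradedFreeResolution.IsMinimal {k : Type u} {σ : Type v} [Field k]
    {I : Ideal (MvPolynomial σ k)} (F : GradedFreeResolution I) : Prop :=
  ∀ i (b : F.ι (i + 1)) (c : F.ι i), constantCoeff (F.d i (Finsupp.single b 1) c) = 0

/-- The number of basis elements of degree `j` in homological degree `i`. If the resolution is
minimal, this is the graded Betti number `b_{i,j}(S ⧸ I)`. -/
noncomputable def GradedFreeResolution.betti {k : Type u} {σ : Type v} [Field k]
    {I : Ideal (MvPolynomial σ k)} (F : GradedFreeResolution I) (i : ℕ) (j : ℤ) : ℕ :=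
  Nat.card {b : F.ι i // F.deg i b = j}

/-- `reg (S ⧸ I) = r`: the module `S ⧸ I` has a minimal graded free resolution, and, whichever one
is used to compute the graded Betti numbers, `r` is the maximum of `j - i` over all `i`, `j` with
`b_{i,j}(S ⧸ I) ≠ 0`. -/
def HasRegularity {k : Type u} {σ : Type v} [Field k]
    (I : Ideal (MvPolynomial σ k)) (r : ℤ) : Prop :=
  (∃ F : GradedFreeResolution I, F.IsMinimal) ∧
    ∀ F : GradedFreeResolution I, F.IsMinimal →
      IsGreatest {s : ℤ | ∃ (i : ℕ) (j : ℤ), F.betti i j ≠ 0 ∧ s = j - i} r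

end MonomialResolution

/-! The Taylor complex on `m_1, …, m_q` has one basis element for each subset `T` of the generators,
in homological degree `|T|` and degree `deg lcm T`. It resolves `S ⧸ M` for every monomial ideal: in
each multidegree it is the chain complex of a full simplex, contracted by coning
(`Taylor.boundary_homotopy_add_cell`).

Dominance makes `lcm T` drop strictly when a generator is removed from `T`
(`degree_sup_lt_degree_sup_insert`), so no matrix entry is a unit and the Taylor resolution is
minimal. Adding a generator raises `|T|` by one and `deg lcm T` by at least one, so `deg lcm T -
|T|` is largest at the full set, where it equals `h - q`.

An arbitrary minimal resolution has basis elements in the same bidegrees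
(`GradedFreeResolution.IsMinimal.betti_ne_zero_iff`). Only the nonvanishing of Betti numbers
matters, so no ranks are compared. -/

namespace MonomialResolution

open MvPolynomial

/-! ### Homogeneous polynomials and components of integer degree. -/

section Homogeneous

variable {k : Type*} {σ : Type*} [Field k]

lemma IsHomogeneousOfDegree.add {p q : MvPolynomial σ k} {d : ℤ}
    (hp : IsHomogeneousOfDegree p d) (hq : IsHomogeneousOfDegree q d) :
    IsHomogeneousOfDegree (p + q) d := by
  classical
  intro a ha
  rcases Finset.mem_union.1 (support_add ha) with h | h
  exacts [hp a h, hq a h]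

lemma isHomogeneousOfDegree_zero (d : ℤ) :
    IsHomogeneousOfDegree (0 : MvPolynomial σ k) d := by
  intro a ha
  simp at ha

lemma isHomogeneousOfDegree_sum {α : Type*} (s : Finset α) (p : α → MvPolynomial σ k) {d : ℤ}
    (h : ∀ i ∈ s, IsHomogeneousOfDegree (p i) d) :
    IsHomogeneousOfDegree (∑ i ∈ s, p i) d := by
  classical
  induction s using Finset.induction_on with
  | empty => simpa using isHomogeneousOfDegree_zero d
  | insert i s hi ih =>
    rw [Finset.sum_insert hi]
    exact (h i (by simp)).add (ih fun j hj => h j (by simp [hj]))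

lemma isHomogeneousOfDegree_monomial (a : σ →₀ ℕ) (c : k) {d : ℤ} (h : (a.degree : ℤ) = d) :
    IsHomogeneousOfDegree (monomial a c) d := by
  classical
  intro b hb
  rw [Finset.mem_singleton.1 (support_monomial_subset hb), h]

lemma IsHomogeneousOfDegree.mul {p q : MvPolynomial σ k} {d e : ℤ}
    (hp : IsHomogeneousOfDegree p d) (hq : IsHomogeneousOfDegree q e) :
    IsHomogeneousOfDegree (p * q) (d + e) := by
  classical
  intro a ha
  obtain ⟨b, hb, c, hc, rfl⟩ := Finset.mem_add.1 (support_mul p q ha)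
  rw [map_add, Nat.cast_add, hp b hb, hq c hc]

/-- Applied to matrix entries of a graded map: a unit entry links basis elements of equal degree. -/
lemma IsHomogeneousOfDegree.eq_zero_of_constantCoeff_ne_zero {p : MvPolynomial σ k} {d : ℤ}
    (hp : IsHomogeneousOfDegree p d) (h : constantCoeff p ≠ 0) : d = 0 := by
  have := hp 0 (mem_support_iff.2 h)
  simpa using this.symm

/-- Integer weights allow components of degree `j - deg c` even when this is negative; they are then
zero. -/
lemma weight_one_int (a : σ →₀ ℕ) :
    Finsupp.weight (fun _ : σ => (1 : ℤ)) a = (a.degree : ℤ) := by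
  simp [Finsupp.weight_apply, Finsupp.sum, Finsupp.degree_apply]

/-- The homogeneous component of a polynomial of degree `d`, an arbitrary integer. -/
noncomputable def component (d : ℤ) : MvPolynomial σ k →ₗ[k] MvPolynomial σ k :=
  weightedHomogeneousComponent (fun _ : σ => (1 : ℤ)) d

lemma coeff_component (d : ℤ) (p : MvPolynomial σ k) (a : σ →₀ ℕ) :
    coeff a (component d p) = if (a.degree : ℤ) = d then coeff a p else 0 := by
  rw [component, coeff_weightedHomogeneousComponent, weight_one_int]

lemma isHomogeneousOfDegree_component (d : ℤ) (p : MvPolynomial σ k) :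
    IsHomogeneousOfDegree (component d p) d := by
  intro a ha
  rw [mem_support_iff, coeff_component] at ha
  by_contra h
  simp [h] at ha

lemma IsHomogeneousOfDegree.component_eq {p : MvPolynomial σ k} {d : ℤ}
    (hp : IsHomogeneousOfDegree p d) : component d p = p := by
  ext a
  rw [coeff_component]
  split_ifs with h
  · rfl
  · by_contra h'
    exact h (hp a (mem_support_iff.2 (Ne.symm h')))

lemma component_mul {q : MvPolynomial σ k} {e : ℤ} (hq : IsHomogeneousOfDegree q e)
    (d : ℤ) (p : MvPolynomial σ k) :
    component d (p * q) = component (d - e) p * q := by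
  classical
  ext a
  rw [coeff_component, coeff_mul, coeff_mul]
  split_ifs with h
  -- Both cases reduce to one pair of exponents: wherever `q` has a nonzero coefficient its exponent
  -- has degree `e`, so the total degree is `d` exactly when the other exponent has degree `d - e`.
  all_goals first
    | refine Finset.sum_congr rfl fun x hx => ?_
    | refine (Finset.sum_eq_zero fun x hx => ?_).symm
  all_goals
    rw [coeff_component]
    by_cases hx' : coeff x.2 q = 0
    · simp [hx']
    have h2 := hq x.2 (mem_support_iff.2 hx')
    rw [← (Finset.HasAntidiagonal.mem_antidiagonal.1 hx : x.1 + x.2 = a), map_add, Nat.cast_add] at h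
  · rw [if_pos (by omega)]
  · rw [if_neg (by omega), zero_mul]

end Homogeneous

/-! ### Graded maps between free modules. -/

section Matrix

variable {k : Type*} {σ : Type*} [Field k] {ι κ : Type*}

/-- An element of the graded free module `⨁ b, S(-deg b)` is homogeneous of degree `j`. -/
def IsHomogeneousElement (deg : ι → ℤ) (j : ℤ) (x : ι →₀ MvPolynomial σ k) : Prop :=
  ∀ c, IsHomogeneousOfDegree (x c) (j - deg c)

/-- The homogeneous component of degree `j` of an element of `⨁ b, S(-deg b)`. -/
noncomputable def elementComponent (deg : ι → ℤ) (j : ℤ) (x : ι →₀ MvPolynomial σ k) :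
    ι →₀ MvPolynomial σ k :=
  Finsupp.onFinset x.support (fun c => component (j - deg c) (x c)) (by
    intro c hc
    rw [Finsupp.mem_support_iff]
    rintro h
    simp [h] at hc)

lemma elementComponent_apply (deg : ι → ℤ) (j : ℤ) (x : ι →₀ MvPolynomial σ k) (c : ι) :
    elementComponent deg j x c = component (j - deg c) (x c) := rfl

lemma linearMap_apply_eq_sum {R : Type*} [CommRing R]
    (A : (ι →₀ R) →ₗ[R] (κ →₀ R)) (x : ι →₀ R) (s : Finset ι) (hs : x.support ⊆ s) (e : κ) :
    A x e = ∑ c ∈ s, x c * A (Finsupp.single c 1) e := by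
  conv_lhs => rw [← Finsupp.sum_single x, Finsupp.sum_of_support_subset _ hs _ (by simp)]
  rw [map_sum, Finsupp.finsetSum_apply]
  refine Finset.sum_congr rfl fun c _ => ?_
  rw [← smul_eq_mul, ← Finsupp.smul_apply, ← map_smul, Finsupp.smul_single, smul_eq_mul, mul_one]

/-- `A` is a graded map of degree `0` between graded free modules. -/
def IsGradedMap (degι : ι → ℤ) (degκ : κ → ℤ)
    (A : (ι →₀ MvPolynomial σ k) →ₗ[MvPolynomial σ k] (κ →₀ MvPolynomial σ k)) : Prop :=
  ∀ b c, IsHomogeneousOfDegree (A (Finsupp.single b 1) c) (degι b - degκ c)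

lemma IsGradedMap.isHomogeneousElement {degι : ι → ℤ} {degκ : κ → ℤ}
    {A : (ι →₀ MvPolynomial σ k) →ₗ[MvPolynomial σ k] (κ →₀ MvPolynomial σ k)}
    (hA : IsGradedMap degι degκ A) {j : ℤ} {x : ι →₀ MvPolynomial σ k}
    (hx : IsHomogeneousElement degι j x) : IsHomogeneousElement degκ j (A x) := by
  intro e
  rw [linearMap_apply_eq_sum A x _ subset_rfl]
  refine isHomogeneousOfDegree_sum _ _ fun c _ => ?_
  have := (hx c).mul (hA c e)
  rwa [sub_add_sub_cancel] at this

lemma IsGradedMap.map_elementComponent {degι : ι → ℤ} {degκ : κ → ℤ}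
    {A : (ι →₀ MvPolynomial σ k) →ₗ[MvPolynomial σ k] (κ →₀ MvPolynomial σ k)}
    (hA : IsGradedMap degι degκ A) (j : ℤ) (x : ι →₀ MvPolynomial σ k) :
    A (elementComponent degι j x) = elementComponent degκ j (A x) := by
  ext1 e
  rw [elementComponent_apply, linearMap_apply_eq_sum A x _ subset_rfl,
    linearMap_apply_eq_sum A (elementComponent degι j x) x.support
      Finsupp.support_onFinset_subset, map_sum]
  refine Finset.sum_congr rfl fun c _ => ?_
  rw [component_mul (hA c e), elementComponent_apply, sub_sub_sub_cancel_right]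

lemma IsHomogeneousElement.elementComponent_eq {deg : ι → ℤ} {j : ℤ}
    {x : ι →₀ MvPolynomial σ k} (hx : IsHomogeneousElement deg j x) :
    elementComponent deg j x = x := by
  ext1 c
  rw [elementComponent_apply, (hx c).component_eq]

lemma IsGradedMap.exists_homogeneous_preimage {degι : ι → ℤ} {degκ : κ → ℤ}
    {A : (ι →₀ MvPolynomial σ k) →ₗ[MvPolynomial σ k] (κ →₀ MvPolynomial σ k)}
    (hA : IsGradedMap degι degκ A) {j : ℤ} {y : ι →₀ MvPolynomial σ k}
    (hy : IsHomogeneousElement degκ j (A y)) :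
    ∃ x, IsHomogeneousElement degι j x ∧ A x = A y :=
  ⟨elementComponent degι j y, fun c => isHomogeneousOfDegree_component _ _, by
    rw [hA.map_elementComponent, hy.elementComponent_eq]⟩

end Matrix

/-- Lifting of a map out of a free module, with prescribed properties of the values on the
basis. -/
lemma exists_lift {R ι M N : Type*} [CommRing R] [AddCommGroup M] [Module R M] [AddCommGroup N]
    [Module R N] (π : M →ₗ[R] N) (φ : (ι →₀ R) →ₗ[R] N) (P : ι → M → Prop)
    (h : ∀ b, ∃ y, P b y ∧ π y = φ (Finsupp.single b 1)) :
    ∃ ψ : (ι →₀ R) →ₗ[R] M, (∀ b, P b (ψ (Finsupp.single b 1))) ∧ ∀ x, π (ψ x) = φ x := by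
  choose y hP hy using h
  refine ⟨Finsupp.linearCombination R y, fun b => by simpa using hP b, fun x => ?_⟩
  have : π ∘ₗ Finsupp.linearCombination R y = φ := by
    ext b
    simp [hy]
  exact LinearMap.congr_fun this x

/-! ### Comparison of resolutions. -/

namespace GradedFreeResolution

variable {k : Type*} {σ : Type*} [Field k] {I : Ideal (MvPolynomial σ k)}

lemma d_comp_d (F : GradedFreeResolution I) (i : ℕ) (x) : F.d i (F.d (i + 1) x) = 0 :=
  (F.exact_succ i).apply_apply_eq_zero x

lemma ε_comp_d (F : GradedFreeResolution I) (x) : F.ε (F.d 0 x) = 0 :=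
  F.exact_zero.apply_apply_eq_zero x

/-- A comparison map between resolutions, with prescribed properties of its values on the
basis. -/
lemma exists_comparison (F F' : GradedFreeResolution I)
    (P : ∀ i, F.ι i → (F'.ι i →₀ MvPolynomial σ k) → Prop)
    (h0 : ∀ b, ∃ y, P 0 b y ∧ F'.ε y = F.ε (Finsupp.single b 1))
    (hstep : ∀ i (f : (F.ι i →₀ MvPolynomial σ k) →ₗ[MvPolynomial σ k]
      (F'.ι i →₀ MvPolynomial σ k)), (∀ b, P i b (f (Finsupp.single b 1))) →
      ∀ b y, F'.d i y = f (F.d i (Finsupp.single b 1)) → ∃ x, P (i + 1) b x ∧ F'.d i x = F'.d i y) :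
    ∃ f : ∀ i, (F.ι i →₀ MvPolynomial σ k) →ₗ[MvPolynomial σ k] (F'.ι i →₀ MvPolynomial σ k),
      (∀ i b, P i b (f i (Finsupp.single b 1))) ∧ (∀ x, F'.ε (f 0 x) = F.ε x) ∧
      ∀ i x, F'.d i (f (i + 1) x) = f i (F.d i x) := by
  -- The second clause of `K` keeps the recursion going: it says that `f ∘ d` lifts through the
  -- differential of `F'`.
  let K : ∀ i, ((F.ι i →₀ MvPolynomial σ k) →ₗ[MvPolynomial σ k]
      (F'.ι i →₀ MvPolynomial σ k)) → Prop := fun i f =>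
    (∀ b, P i b (f (Finsupp.single b 1))) ∧ ∀ x, ∃ y, F'.d i y = f (F.d i x)
  obtain ⟨f0, hP0, hf0⟩ := exists_lift F'.ε F.ε (P 0) h0
  have K0 : K 0 f0 := ⟨hP0, fun x => (F'.exact_zero _).1 (by rw [hf0, F.ε_comp_d])⟩
  have step : ∀ i f, K i f → ∃ f', K (i + 1) f' ∧ ∀ x, F'.d i (f' x) = f (F.d i x) := by
    intro i f hf
    obtain ⟨f', hP, hf'⟩ := exists_lift (F'.d i) (f ∘ₗ F.d i) (P (i + 1)) (fun b => by
      obtain ⟨y, hy⟩ := hf.2 (Finsupp.single b 1)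
      obtain ⟨x, hx, hxy⟩ := hstep i f hf.1 b y hy
      exact ⟨x, hx, hxy.trans hy⟩)
    refine ⟨f', ⟨hP, fun x => (F'.exact_succ i _).1 ?_⟩, hf'⟩
    rw [hf', LinearMap.comp_apply, F.d_comp_d, map_zero]
  choose! next hnextK hnext using step
  let g : ∀ i, {f // K i f} := fun i =>
    Nat.rec ⟨f0, K0⟩ (fun i f => ⟨next i f.1, hnextK i f.1 f.2⟩) i
  exact ⟨fun i => (g i).1, fun i => (g i).2.1, hf0, fun i => hnext i (g i).1 (g i).2⟩

lemma exists_chainMap (F F' : GradedFreeResolution I) :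
    ∃ f : ∀ i, (F.ι i →₀ MvPolynomial σ k) →ₗ[MvPolynomial σ k] (F'.ι i →₀ MvPolynomial σ k),
      (∀ x, F'.ε (f 0 x) = F.ε x) ∧ ∀ i x, F'.d i (f (i + 1) x) = f i (F.d i x) := by
  obtain ⟨f, -, h⟩ := exists_comparison F F' (fun _ _ _ => True)
    (fun b => (F'.surjective _).imp fun _ h => ⟨trivial, h⟩) (fun _ _ _ _ y _ => ⟨y, trivial, rfl⟩)
  exact ⟨f, h⟩

/-- Homogeneity is assumed only for the lifts through the augmentation; in higher degrees any
preimage can be replaced by its homogeneous component. -/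
lemma exists_gradedChainMap (F F' : GradedFreeResolution I)
    (h0 : ∀ b, ∃ y, IsHomogeneousElement (F'.deg 0) (F.deg 0 b) y ∧
      F'.ε y = F.ε (Finsupp.single b 1)) :
    ∃ f : ∀ i, (F.ι i →₀ MvPolynomial σ k) →ₗ[MvPolynomial σ k] (F'.ι i →₀ MvPolynomial σ k),
      (∀ i, IsGradedMap (F.deg i) (F'.deg i) (f i)) ∧ (∀ x, F'.ε (f 0 x) = F.ε x) ∧
      ∀ i x, F'.d i (f (i + 1) x) = f i (F.d i x) := by
  refine exists_comparison F F' (fun i b y => IsHomogeneousElement (F'.deg i) (F.deg i b) y) h0 ?_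
  intro i f hf b y hy
  refine IsGradedMap.exists_homogeneous_preimage (F'.d_homogeneous i) ?_
  rw [hy]
  exact IsGradedMap.isHomogeneousElement hf (F.d_homogeneous i b)

/-- A chain endomorphism `φ` of a resolution that induces zero on `S ⧸ I` is null-homotopic; in a
minimal resolution its matrices therefore have entries without constant term. -/
lemma IsMinimal.constantCoeff_eq_zero {F : GradedFreeResolution I} (hF : F.IsMinimal)
    (φ : ∀ i, (F.ι i →₀ MvPolynomial σ k) →ₗ[MvPolynomial σ k] (F.ι i →₀ MvPolynomial σ k))
    (hε : ∀ x, F.ε (φ 0 x) = 0) (hφ : ∀ i x, F.d i (φ (i + 1) x) = φ i (F.d i x))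
    (i : ℕ) (x) (c : F.ι i) : constantCoeff (φ i x c) = 0 := by
  have hd : ∀ i x c, constantCoeff (F.d i x c) = 0 := by
    intro i x c
    rw [linearMap_apply_eq_sum _ _ _ subset_rfl, map_sum]
    exact Finset.sum_eq_zero fun b _ => by rw [map_mul, hF i b c, mul_zero]
  have lift : ∀ i (ψ : (F.ι i →₀ MvPolynomial σ k) →ₗ[MvPolynomial σ k]
      (F.ι i →₀ MvPolynomial σ k)), (∀ x, ∃ y, F.d i y = ψ x) →
      ∃ h : (F.ι i →₀ MvPolynomial σ k) →ₗ[MvPolynomial σ k]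
        (F.ι (i + 1) →₀ MvPolynomial σ k), ∀ x, F.d i (h x) = ψ x := fun i ψ hψ => by
    obtain ⟨h, -, hh⟩ := exists_lift (F.d i) ψ (fun _ _ => True)
      (fun b => (hψ _).imp fun _ h => ⟨trivial, h⟩)
    exact ⟨h, hh⟩
  obtain ⟨h0, hh0⟩ := lift 0 (φ 0) fun x => (F.exact_zero _).1 (hε x)
  -- Only `d h d = φ d` is carried from one degree to the next. It already puts `φ - h d` in the
  -- kernel of `d`, hence in the image of the next differential.
  have step : ∀ i (h : (F.ι i →₀ MvPolynomial σ k) →ₗ[MvPolynomial σ k]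
        (F.ι (i + 1) →₀ MvPolynomial σ k)),
      (∀ x, F.d i (h (F.d i x)) = φ i (F.d i x)) →
      ∃ h' : (F.ι (i + 1) →₀ MvPolynomial σ k) →ₗ[MvPolynomial σ k]
        (F.ι (i + 1 + 1) →₀ MvPolynomial σ k),
        ∀ x, F.d (i + 1) (h' x) = φ (i + 1) x - h (F.d i x) := by
    intro i h hh
    obtain ⟨h', hh'⟩ := lift (i + 1) (φ (i + 1) - h ∘ₗ F.d i) fun x => (F.exact_succ i _).1 (by
      simp [hφ, hh])
    exact ⟨h', hh'⟩
  have main : ∀ i, ∃ h : (F.ι i →₀ MvPolynomial σ k) →ₗ[MvPolynomial σ k]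
      (F.ι (i + 1) →₀ MvPolynomial σ k), ∀ x, F.d i (h (F.d i x)) = φ i (F.d i x) := by
    intro i
    induction i with
    | zero => exact ⟨h0, fun x => hh0 _⟩
    | succ i ih =>
      obtain ⟨h, hh⟩ := ih
      obtain ⟨h', hh'⟩ := step i h hh
      exact ⟨h', fun x => by rw [hh', F.d_comp_d, map_zero, sub_zero]⟩
  cases i with
  | zero => rw [← hh0, hd]
  | succ i =>
    obtain ⟨h, hh⟩ := main i
    obtain ⟨h', hh'⟩ := step i h hh
    have : φ (i + 1) x = F.d (i + 1) (h' x) + h (F.d i x) := by rw [hh', sub_add_cancel]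
    rw [this, Finsupp.add_apply, map_add, hd, zero_add, linearMap_apply_eq_sum _ _ _ subset_rfl,
      map_sum]
    exact Finset.sum_eq_zero fun b _ => by rw [map_mul, hd, zero_mul]

/-- If `g ∘ f` is an endomorphism of a minimal resolution over the identity of `S ⧸ I`, then each
basis element has a nonzero path through the matrices of `f` and `g` modulo the variables. -/
lemma IsMinimal.exists_constantCoeff_ne_zero {F F' : GradedFreeResolution I} (hF : F.IsMinimal)
    (f : ∀ i, (F.ι i →₀ MvPolynomial σ k) →ₗ[MvPolynomial σ k] (F'.ι i →₀ MvPolynomial σ k))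
    (g : ∀ i, (F'.ι i →₀ MvPolynomial σ k) →ₗ[MvPolynomial σ k] (F.ι i →₀ MvPolynomial σ k))
    (hfε : ∀ x, F'.ε (f 0 x) = F.ε x) (hf : ∀ i x, F'.d i (f (i + 1) x) = f i (F.d i x))
    (hgε : ∀ x, F.ε (g 0 x) = F'.ε x) (hg : ∀ i x, F.d i (g (i + 1) x) = g i (F'.d i x))
    (i : ℕ) (b : F.ι i) :
    ∃ c, constantCoeff (f i (Finsupp.single b 1) c) ≠ 0 ∧
      constantCoeff (g i (Finsupp.single c 1) b) ≠ 0 := by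
  -- `g ∘ f - id` induces zero on `S ⧸ I`, so its diagonal entry at `b` has no constant term. If
  -- every path through some `c` vanished, that constant term would be `-1`.
  have key := hF.constantCoeff_eq_zero (fun i => g i ∘ₗ f i - LinearMap.id)
    (by simp [hfε, hgε]) (by simp [hf, hg]) i (Finsupp.single b 1) b
  by_contra! hcon
  simp only [LinearMap.sub_apply, LinearMap.comp_apply, LinearMap.id_apply, Finsupp.sub_apply,
    map_sub, Finsupp.single_eq_same, map_one] at key
  rw [linearMap_apply_eq_sum (g i) _ _ subset_rfl, map_sum, Finset.sum_eq_zero] at key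
  · simp at key
  · intro c _
    rw [map_mul]
    by_cases hc : constantCoeff (f i (Finsupp.single b 1) c) = 0
    · rw [hc, zero_mul]
    · rw [hcon c hc, mul_zero]

lemma betti_ne_zero_iff (F : GradedFreeResolution I) (i : ℕ) (j : ℤ) :
    F.betti i j ≠ 0 ↔ ∃ b, F.deg i b = j := by
  have := F.finite_ι i
  rw [betti, Nat.card_ne_zero, nonempty_subtype]
  exact and_iff_left inferInstance

/-- Two minimal resolutions, compared by a graded map in one direction, have their basis elements
in the same degrees. -/
lemma IsMinimal.betti_ne_zero_iff {F F' : GradedFreeResolution I} (hF : F.IsMinimal)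
    (hF' : F'.IsMinimal)
    (h0 : ∀ b, ∃ y, IsHomogeneousElement (F'.deg 0) (F.deg 0 b) y ∧
      F'.ε y = F.ε (Finsupp.single b 1)) (i : ℕ) (j : ℤ) :
    F.betti i j ≠ 0 ↔ F'.betti i j ≠ 0 := by
  obtain ⟨f, hfg, hfε, hf⟩ := exists_gradedChainMap F F' h0
  -- `g` need not be graded: in both directions the degrees are read off the entries of `f`.
  obtain ⟨g, hgε, hg⟩ := exists_chainMap F' F
  have hdeg : ∀ b c, constantCoeff (f i (Finsupp.single b 1) c) ≠ 0 → F.deg i b = F'.deg i c :=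
    fun b c h => sub_eq_zero.1 ((hfg i b c).eq_zero_of_constantCoeff_ne_zero h)
  rw [F.betti_ne_zero_iff, F'.betti_ne_zero_iff]
  constructor
  · rintro ⟨b, rfl⟩
    obtain ⟨c, hc, -⟩ := hF.exists_constantCoeff_ne_zero f g hfε hf hgε hg i b
    exact ⟨c, (hdeg b c hc).symm⟩
  · rintro ⟨c, rfl⟩
    obtain ⟨b, -, hb⟩ := hF'.exists_constantCoeff_ne_zero g f hgε hg hfε hf i c
    exact ⟨b, hdeg b c hb⟩

end GradedFreeResolution

/-! ### The Taylor complex and its contracting homotopy. -/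

namespace Taylor

section Sign

variable {q : ℕ}

/-- The sign with which the face `T \ {i}` occurs in the boundary of the simplex `T`. -/
def sign (i : Fin q) (T : Finset (Fin q)) : ℤ := (-1) ^ (T.filter (· < i)).card

lemma sign_eq_one_of_le {i : Fin q} {T : Finset (Fin q)} (h : ∀ j ∈ T, i ≤ j) : sign i T = 1 := by
  rw [sign, Finset.filter_false_of_mem fun j hj => not_lt.2 (h j hj), Finset.card_empty, pow_zero]

lemma sign_insert_of_lt {i v : Fin q} {T : Finset (Fin q)} (hv : v ∉ T) (h : v < i) :
    sign i (insert v T) = -sign i T := by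
  rw [sign, sign, Finset.filter_insert, if_pos h, Finset.card_insert_of_notMem (by simp [hv]),
    pow_succ, mul_neg_one]

lemma sign_insert_of_not_lt {i v : Fin q} {T : Finset (Fin q)} (h : ¬ v < i) :
    sign i (insert v T) = sign i T := by
  rw [sign, sign, Finset.filter_insert, if_neg h]

/-- Removing the smaller index `i` changes the count for `j` by one, while removing `j` leaves the
count for `i` alone. This makes the two orders of removal cancel in the square of the boundary. -/
lemma sign_mul_sign_erase {i j : Fin q} {T : Finset (Fin q)} (hi : i ∈ T) (hj : j ∈ T)
    (hij : i < j) : sign i T * sign j (T.erase i) = -(sign j T * sign i (T.erase j)) := by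
  have h1 : sign j T = -sign j (T.erase i) := by
    conv_lhs => rw [← Finset.insert_erase hi]
    exact sign_insert_of_lt (Finset.notMem_erase i T) hij
  have h2 : sign i T = sign i (T.erase j) := by
    conv_lhs => rw [← Finset.insert_erase hj]
    exact sign_insert_of_not_lt hij.not_gt
  rw [h1, h2]
  ring

end Sign

variable (k : Type*) {σ : Type*} [Field k] {q : ℕ} (m : Fin q → (σ →₀ ℕ))

/-- The element of multidegree `a` of the Taylor complex which is a monomial times the basis
element of `T`; meaningful if `lcm T` divides `x ^ a`. -/
noncomputable def cell (a : σ →₀ ℕ) (T : Finset (Fin q)) :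
    Finset (Fin q) →₀ MvPolynomial σ k :=
  Finsupp.single T (monomial (a - T.sup m) 1)

/-- The differential of the Taylor complex. -/
noncomputable def boundary : (Finset (Fin q) →₀ MvPolynomial σ k) →ₗ[MvPolynomial σ k]
    (Finset (Fin q) →₀ MvPolynomial σ k) :=
  Finsupp.linearCombination _ fun T => ∑ i ∈ T, sign i T • cell k m (T.sup m) (T.erase i)

lemma single_one_eq_cell (T : Finset (Fin q)) :
    Finsupp.single T (1 : MvPolynomial σ k) = cell k m (T.sup m) T := by
  simp [cell]

lemma single_monomial_eq_cell (T : Finset (Fin q)) (u : σ →₀ ℕ) (c : k) :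
    Finsupp.single T (monomial u c) = c • cell k m (u + T.sup m) T := by
  rw [cell, add_tsub_cancel_right, Finsupp.smul_single, smul_monomial, smul_eq_mul, mul_one]

/-- In a fixed multidegree `a` the monomial coefficients disappear and the boundary is that of a
simplex. -/
lemma boundary_cell {a : σ →₀ ℕ} {T : Finset (Fin q)} (h : T.sup m ≤ a) :
    boundary k m (cell k m a T) = ∑ i ∈ T, sign i T • cell k m a (T.erase i) := by
  rw [cell, boundary, Finsupp.linearCombination_single, Finset.smul_sum]
  refine Finset.sum_congr rfl fun i _ => ?_
  rw [smul_comm, cell, cell, Finsupp.smul_single, smul_eq_mul, monomial_mul, mul_one,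
    tsub_add_tsub_cancel h (Finset.sup_mono (Finset.erase_subset i T))]

lemma boundary_boundary (x : Finset (Fin q) →₀ MvPolynomial σ k) :
    boundary k m (boundary k m x) = 0 := by
  suffices boundary k m ∘ₗ boundary k m = 0 from LinearMap.congr_fun this x
  ext1 T
  ext1
  simp only [LinearMap.comp_apply, Finsupp.lsingle_apply, LinearMap.zero_apply]
  rw [single_one_eq_cell k m, boundary_cell k m le_rfl, map_sum]
  have : ∀ i ∈ T, boundary k m (sign i T • cell k m (T.sup m) (T.erase i)) =
      ∑ j ∈ T.erase i,
        (sign i T * sign j (T.erase i)) • cell k m (T.sup m) ((T.erase i).erase j) := by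
    intro i _
    rw [map_zsmul, boundary_cell k m (Finset.sup_mono (Finset.erase_subset i T)), Finset.smul_sum]
    simp only [mul_smul]
  rw [Finset.sum_congr rfl this, Finset.sum_sigma']
  -- The term removing `i` then `j` cancels the term removing `j` then `i`.
  refine Finset.sum_involution (fun x _ => ⟨x.2, x.1⟩) ?_ ?_ ?_ ?_
  · rintro ⟨i, j⟩ hx
    simp only [Finset.mem_sigma, Finset.mem_erase] at hx
    obtain ⟨hi, hji, hj⟩ := hx
    simp only
    rw [Finset.erase_right_comm (a := j), ← add_smul]
    rcases lt_or_gt_of_ne hji with h | h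
    · rw [sign_mul_sign_erase hj hi h, add_neg_cancel, zero_smul]
    · rw [sign_mul_sign_erase hi hj h, neg_add_cancel, zero_smul]
  · rintro ⟨i, j⟩ hx _ h
    simp only [Finset.mem_sigma, Finset.mem_erase] at hx
    exact hx.2.1 (congrArg Sigma.fst h)
  · rintro ⟨i, j⟩ hx
    simp only [Finset.mem_sigma, Finset.mem_erase] at hx ⊢
    exact ⟨hx.2.2, hx.2.1.symm, hx.1⟩
  · rintro ⟨i, j⟩ _
    rfl

open Classical in
/-- The value of the contracting homotopy on a cell: insert the first generator dividing
`x ^ a`. -/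
noncomputable def cone (a : σ →₀ ℕ) (T : Finset (Fin q)) :
    Finset (Fin q) →₀ MvPolynomial σ k :=
  if h : (Finset.univ.filter fun i => m i ≤ a).Nonempty then
    if (Finset.univ.filter fun i => m i ≤ a).min' h ∈ T then 0
    else cell k m a (insert ((Finset.univ.filter fun i => m i ≤ a).min' h) T)
  else 0

lemma cone_eq {a : σ →₀ ℕ} {v : Fin q} (hv : IsLeast {i | m i ≤ a} v) (T : Finset (Fin q)) :
    cone k m a T = if v ∈ T then 0 else cell k m a (insert v T) := by
  classical
  have h : (Finset.univ.filter fun i => m i ≤ a).Nonempty := ⟨v, by simpa using hv.1⟩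
  have : (Finset.univ.filter fun i => m i ≤ a).min' h = v :=
    (Finset.isLeast_min' _ h).unique (by simpa using hv)
  rw [cone, dif_pos h, this]

/-- The contracting homotopy of the Taylor complex. -/
noncomputable def homotopy : (Finset (Fin q) →₀ MvPolynomial σ k) →ₗ[k]
    (Finset (Fin q) →₀ MvPolynomial σ k) :=
  Finsupp.lsum k fun T => (basisMonomials σ k).constr k fun u => cone k m (u + T.sup m) T

lemma homotopy_cell {a : σ →₀ ℕ} {T : Finset (Fin q)} (h : T.sup m ≤ a) :
    homotopy k m (cell k m a T) = cone k m a T := by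
  have := (basisMonomials σ k).constr_basis k (fun u => cone k m (u + T.sup m) T) (a - T.sup m)
  rw [coe_basisMonomials, tsub_add_cancel_of_le h] at this
  rw [homotopy, cell, Finsupp.lsum_single, this]

/-- The homotopy cones from the first generator `v` dividing `x ^ a`; it is only `k`-linear because
`v` depends on `a`. Nonemptiness of `T` guarantees that `v` exists. If `v ∈ T`, only the face
without `v` contributes. If `v ∉ T`, removing `v` from the cone returns `T`, and the other faces
cancel because `v` precedes them and flips their signs. -/
lemma boundary_homotopy_add_cell {a : σ →₀ ℕ} {T : Finset (Fin q)} (h : T.sup m ≤ a)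
    (hT : T.Nonempty) :
    boundary k m (homotopy k m (cell k m a T)) + homotopy k m (boundary k m (cell k m a T)) =
      cell k m a T := by
  classical
  have hle : ∀ i ∈ T, m i ≤ a := fun i hi => (Finset.le_sup hi).trans h
  obtain ⟨v, hv⟩ : ∃ v, IsLeast {i | m i ≤ a} v := by
    obtain ⟨i, hi⟩ := hT
    have h : (Finset.univ.filter fun i => m i ≤ a).Nonempty := ⟨i, by simpa using hle i hi⟩
    exact ⟨_, by simpa using Finset.isLeast_min' _ h⟩
  have hvT : ∀ j ∈ T, v ≤ j := fun j hj => hv.2 (hle j hj)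
  rw [homotopy_cell k m h, boundary_cell k m h, map_sum]
  have hterm : ∀ i ∈ T, homotopy k m (sign i T • cell k m a (T.erase i)) =
      if v ∈ T.erase i then 0 else sign i T • cell k m a (insert v (T.erase i)) := by
    intro i _
    rw [map_zsmul, homotopy_cell k m ((Finset.sup_mono (Finset.erase_subset i T)).trans h),
      cone_eq k m hv, smul_ite, smul_zero]
  rw [Finset.sum_congr rfl hterm, cone_eq k m hv]
  by_cases hmem : v ∈ T
  · rw [if_pos hmem, map_zero, zero_add, Finset.sum_eq_single_of_mem v hmem, if_neg (by simp),
      sign_eq_one_of_le hvT, one_smul, Finset.insert_erase hmem]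
    intro i _ hi
    rw [if_pos (Finset.mem_erase.2 ⟨hi.symm, hmem⟩)]
  · have hsup : (insert v T).sup m ≤ a := by
      rw [Finset.sup_insert]
      exact sup_le hv.1 h
    rw [if_neg hmem, boundary_cell k m hsup, Finset.sum_insert hmem, Finset.erase_insert hmem,
      sign_eq_one_of_le (by simpa using hvT), one_smul, add_assoc, ← Finset.sum_add_distrib,
      Finset.sum_eq_zero, add_zero]
    intro i hi
    have hvi : v ≠ i := fun h => hmem (h ▸ hi)
    rw [if_neg (fun h => hmem (Finset.mem_of_mem_erase h)), Finset.erase_insert_of_ne hvi,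
      sign_insert_of_lt hmem (lt_of_le_of_ne (hvT i hi) hvi), neg_smul, neg_add_cancel]

/-- The part of the Taylor complex in homological degree `i`. -/
noncomputable abbrev part (i : ℕ) :
    Submodule (MvPolynomial σ k) (Finset (Fin q) →₀ MvPolynomial σ k) :=
  Finsupp.supported (MvPolynomial σ k) (MvPolynomial σ k) {T : Finset (Fin q) | T.card = i}

/-- The scalars come from `k` rather than from `S`, so this applies to the homotopy as well. -/
lemma part_induction {i : ℕ} (p : (Finset (Fin q) →₀ MvPolynomial σ k) → Prop) (hzero : p 0)
    (hadd : ∀ x y, p x → p y → p (x + y))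
    (hcell : ∀ (c : k) a (T : Finset (Fin q)), T.card = i → T.sup m ≤ a → p (c • cell k m a T))
    {x : Finset (Fin q) →₀ MvPolynomial σ k} (hx : x ∈ part k i) : p x := by
  have hsingle : ∀ T : Finset (Fin q), T.card = i → ∀ f : MvPolynomial σ k,
      p (Finsupp.single T f) := by
    intro T hT f
    induction f using MvPolynomial.induction_on' with
    | monomial u c =>
      rw [single_monomial_eq_cell k m]
      exact hcell c _ T hT le_add_self
    | add f g hf hg =>
      rw [Finsupp.single_add]
      exact hadd _ _ hf hg
  rw [← Finsupp.sum_single x]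
  exact Finset.sum_induction _ p hadd hzero fun T hT => hsingle T (hx hT) _

lemma boundary_homotopy_add {i : ℕ} {x : Finset (Fin q) →₀ MvPolynomial σ k}
    (hx : x ∈ part k (i + 1)) :
    boundary k m (homotopy k m x) + homotopy k m (boundary k m x) = x := by
  refine part_induction k m (fun x => boundary k m (homotopy k m x) +
    homotopy k m (boundary k m x) = x) (by simp) ?_ ?_ hx
  · intro x y hx hy
    simp only [map_add]
    rw [add_add_add_comm, hx, hy]
  · intro c a T hT ha
    rw [map_smul, LinearMap.map_smul_of_tower, LinearMap.map_smul_of_tower, map_smul, ← smul_add,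
      boundary_homotopy_add_cell k m ha (Finset.card_pos.1 (by omega))]

lemma cell_mem_part (a : σ →₀ ℕ) (T : Finset (Fin q)) : cell k m a T ∈ part k T.card :=
  Finsupp.single_mem_supported _ _ rfl

lemma boundary_mem_part {i : ℕ} {x : Finset (Fin q) →₀ MvPolynomial σ k}
    (hx : x ∈ part k (i + 1)) : boundary k m x ∈ part k i := by
  refine part_induction k m (fun x => boundary k m x ∈ part k i) (by simp) ?_ ?_ hx
  · intro x y hx hy
    simp only [map_add]
    exact add_mem hx hy
  · intro c a T hT ha
    rw [LinearMap.map_smul_of_tower, boundary_cell k m ha]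
    refine Submodule.smul_of_tower_mem _ _ (sum_mem fun j hj => zsmul_mem ?_ _)
    have := cell_mem_part k m a (T.erase j)
    rwa [Finset.card_erase_of_mem hj, hT, Nat.add_sub_cancel] at this

lemma homotopy_mem_part {i : ℕ} {x : Finset (Fin q) →₀ MvPolynomial σ k}
    (hx : x ∈ part k i) : homotopy k m x ∈ part k (i + 1) := by
  refine part_induction k m (fun x => homotopy k m x ∈ part k (i + 1)) (by simp) ?_ ?_ hx
  · intro x y hx hy
    simp only [map_add]
    exact add_mem hx hy
  · intro c a T hT ha
    rw [map_smul, homotopy_cell k m ha]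
    refine Submodule.smul_of_tower_mem _ _ ?_
    unfold cone
    split_ifs with h h'
    · exact zero_mem _
    · have := cell_mem_part k m a
        (insert ((Finset.univ.filter fun i => m i ≤ a).min' h) T)
      rwa [Finset.card_insert_of_notMem h', hT] at this
    · exact zero_mem _

/-- The part of the Taylor complex in homological degree `i` is free on the `i`-element sets. -/
noncomputable def partEquiv (i : ℕ) : part (σ := σ) (q := q) k i ≃ₗ[MvPolynomial σ k]
    ({T : Finset (Fin q) | T.card = i} →₀ MvPolynomial σ k) :=
  Finsupp.supportedEquivFinsupp _

/-- The differential of the Taylor complex in homological degree `i + 1`. -/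
noncomputable def differential (i : ℕ) :
    ({T : Finset (Fin q) | T.card = i + 1} →₀ MvPolynomial σ k) →ₗ[MvPolynomial σ k]
      ({T : Finset (Fin q) | T.card = i} →₀ MvPolynomial σ k) :=
  (partEquiv k i).toLinearMap ∘ₗ
    (boundary k m).restrict (fun _ hx => boundary_mem_part k m hx) ∘ₗ
    (partEquiv k (i + 1)).symm.toLinearMap

lemma differential_partEquiv (i : ℕ) (x : part k (i + 1)) :
    differential k m i (partEquiv k _ x) =
      partEquiv k _ (⟨boundary k m x.1, boundary_mem_part k m x.2⟩ : part k i) := by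
  simp [differential, LinearMap.restrict_apply]

lemma differential_exact (i : ℕ) :
    Function.Exact (differential k m (i + 1)) (differential k m i) := by
  intro y
  obtain ⟨y, rfl⟩ := (partEquiv k _).surjective y
  rw [differential_partEquiv, LinearEquiv.map_eq_zero_iff, Subtype.ext_iff]
  constructor
  · intro h
    refine ⟨partEquiv k _ ⟨homotopy k m y.1, homotopy_mem_part k m y.2⟩, ?_⟩
    rw [differential_partEquiv]
    congr 1
    ext1
    have := boundary_homotopy_add k m y.2
    rwa [show boundary k m y.1 = 0 from h, map_zero, add_zero] at this
  · rintro ⟨x, hx⟩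
    obtain ⟨x, rfl⟩ := (partEquiv k _).surjective x
    rw [differential_partEquiv, EmbeddingLike.apply_eq_iff_eq] at hx
    rw [← hx]
    exact boundary_boundary k m x.1

lemma differential_single_apply (i : ℕ) (b : {T : Finset (Fin q) | T.card = i + 1})
    (c : {T : Finset (Fin q) | T.card = i}) :
    differential k m i (Finsupp.single b 1) c =
      ∑ j ∈ b.1, sign j b.1 • cell k m (b.1.sup m) (b.1.erase j) c.1 := by
  have hb : Finsupp.single b (1 : MvPolynomial σ k) = partEquiv k _
      (⟨Finsupp.single b.1 1, Finsupp.single_mem_supported _ _ b.2⟩ : part k (i + 1)) := by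
    rw [← LinearEquiv.symm_apply_eq]
    ext1
    rw [partEquiv, Finsupp.supportedEquivFinsupp_symm_single]
  rw [hb, differential_partEquiv, partEquiv, Finsupp.supportedEquivFinsupp_apply_apply]
  simp only
  rw [single_one_eq_cell k m, boundary_cell k m le_rfl, Finsupp.finsetSum_apply]
  simp

end Taylor

/-! ### The Taylor complex as a graded free resolution. -/

namespace Taylor

variable (k : Type*) {σ : Type*} [Field k] {q : ℕ} (m : Fin q → (σ →₀ ℕ))

lemma differential_isGradedMap (i : ℕ) :
    IsGradedMap (fun T => ((T.1.sup m).degree : ℤ)) (fun T => ((T.1.sup m).degree : ℤ))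
      (differential k m i) := by
  intro b c
  rw [differential_single_apply]
  refine isHomogeneousOfDegree_sum _ _ fun j _ => ?_
  by_cases h : b.1.erase j = c.1
  · have hle : c.1.sup m ≤ b.1.sup m := Finset.sup_mono (h ▸ Finset.erase_subset j b.1)
    rw [cell, h, Finsupp.single_eq_same, ← Int.cast_smul_eq_zsmul k, smul_monomial]
    refine isHomogeneousOfDegree_monomial _ _ ?_
    have := congrArg Finsupp.degree (tsub_add_cancel_of_le hle)
    rw [map_add] at this
    dsimp only
    rw [← this, Nat.cast_add, add_sub_cancel_right]
  · rw [cell, Finsupp.single_eq_of_ne' h, smul_zero]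
    exact isHomogeneousOfDegree_zero _

/-- A nonzero entry is, up to sign, the monomial `lcm T / lcm (T \ {j})`, which is constant only if
the two lcms agree. -/
lemma constantCoeff_differential (hm : ∀ T : Finset (Fin q), ∀ i ∈ T, (T.erase i).sup m ≠ T.sup m)
    (i : ℕ) (b : {T : Finset (Fin q) | T.card = i + 1}) (c : {T : Finset (Fin q) | T.card = i}) :
    constantCoeff (differential k m i (Finsupp.single b 1) c) = 0 := by
  classical
  rw [differential_single_apply, map_sum]
  refine Finset.sum_eq_zero fun j hj => ?_
  rw [map_zsmul, cell, Finsupp.single_apply]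
  split_ifs
  · rw [constantCoeff_monomial, if_neg, smul_zero]
    intro h
    exact hm b.1 j hj ((Finset.sup_mono (Finset.erase_subset j b.1)).antisymm
      (tsub_eq_zero_iff_le.1 h))
  · simp

/-- The basis element of the Taylor complex in homological degree `0`. -/
def emptyFace : {T : Finset (Fin q) | T.card = 0} := ⟨∅, Finset.card_empty⟩

lemma eq_emptyFace (b : {T : Finset (Fin q) | T.card = 0}) : b = emptyFace :=
  Subtype.ext (Finset.card_eq_zero.1 b.2)

lemma eq_single_emptyFace (y : {T : Finset (Fin q) | T.card = 0} →₀ MvPolynomial σ k) :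
    y = Finsupp.single emptyFace (y emptyFace) := by
  ext1 b
  rw [eq_emptyFace b, Finsupp.single_eq_same]

lemma differential_zero_single (i : Fin q) :
    differential k m 0 (Finsupp.single ⟨{i}, Finset.card_singleton i⟩ 1) =
      Finsupp.single emptyFace (monomial (m i) 1) := by
  ext1 b
  rw [eq_emptyFace b, differential_single_apply, Finset.sum_singleton,
    sign_eq_one_of_le (by simp), one_smul]
  simp [emptyFace, cell, bot_eq_zero]

/-- The augmentation of the Taylor complex. -/
noncomputable def augmentation (I : Ideal (MvPolynomial σ k)) :
    ({T : Finset (Fin q) | T.card = 0} →₀ MvPolynomial σ k) →ₗ[MvPolynomial σ k]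
      (MvPolynomial σ k ⧸ I) :=
  Finsupp.linearCombination _ fun _ => Ideal.Quotient.mk I 1

variable {k}

lemma augmentation_single (I : Ideal (MvPolynomial σ k)) (b : {T : Finset (Fin q) | T.card = 0})
    (p : MvPolynomial σ k) :
    augmentation k I (Finsupp.single b p) = Ideal.Quotient.mk I p := by
  rw [augmentation, Finsupp.linearCombination_single]
  exact congrArg (Ideal.Quotient.mk I) (mul_one p)

lemma augmentation_exact {I : Ideal (MvPolynomial σ k)}
    (hI : I = Ideal.span (Set.range fun i => monomial (m i) (1 : k))) :
    Function.Exact (differential k m 0) (augmentation k I) := by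
  intro y
  constructor
  · intro hy
    rw [eq_single_emptyFace k y, augmentation_single, Ideal.Quotient.eq_zero_iff_mem] at hy
    -- The elements of `S` whose multiple of the empty face is a boundary form an ideal, so it
    -- suffices to check the generators of `I`.
    have hle : I ≤ (LinearMap.range (differential k m 0)).comap (Finsupp.lsingle emptyFace) := by
      rw [hI, Ideal.span, Submodule.span_le]
      rintro _ ⟨i, rfl⟩
      exact ⟨_, differential_zero_single k m i⟩
    rw [eq_single_emptyFace k y]
    exact hle hy
  · rintro ⟨x, rfl⟩
    suffices augmentation k I ∘ₗ differential k m 0 = 0 from LinearMap.congr_fun this x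
    ext1 ⟨b, hb⟩
    ext1
    obtain ⟨i, rfl⟩ := Finset.card_eq_one.1 hb
    simp only [LinearMap.comp_apply, Finsupp.lsingle_apply, LinearMap.zero_apply]
    rw [differential_zero_single, augmentation_single, Ideal.Quotient.eq_zero_iff_mem, hI]
    exact Ideal.subset_span ⟨i, rfl⟩

lemma augmentation_surjective (I : Ideal (MvPolynomial σ k)) :
    Function.Surjective (augmentation (q := q) k I) := by
  intro y
  obtain ⟨p, rfl⟩ := Ideal.Quotient.mk_surjective y
  exact ⟨Finsupp.single emptyFace p, augmentation_single I _ p⟩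

/-- The Taylor resolution of the ideal generated by the monomials `m i`. -/
noncomputable def resolution {I : Ideal (MvPolynomial σ k)}
    (hI : I = Ideal.span (Set.range fun i => monomial (m i) (1 : k))) :
    GradedFreeResolution I where
  ι i := {T : Finset (Fin q) | T.card = i}
  finite_ι _ := inferInstance
  deg _ T := (T.1.sup m).degree
  d := differential k m
  ε := augmentation k I
  d_homogeneous := differential_isGradedMap k m
  ε_homogeneous b := ⟨1, by
    rw [eq_emptyFace b]
    exact isHomogeneousOfDegree_monomial 0 1 (by simp [emptyFace, bot_eq_zero]), augmentation_single I b 1⟩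
  exact_succ := differential_exact k m
  exact_zero := augmentation_exact m hI
  surjective := augmentation_surjective I

lemma betti_resolution_ne_zero_iff {I : Ideal (MvPolynomial σ k)}
    (hI : I = Ideal.span (Set.range fun i => monomial (m i) (1 : k))) (i : ℕ) (j : ℤ) :
    (resolution m hI).betti i j ≠ 0 ↔
      ∃ T : Finset (Fin q), T.card = i ∧ ((T.sup m).degree : ℤ) = j := by
  rw [GradedFreeResolution.betti_ne_zero_iff]
  exact ⟨fun ⟨b, hb⟩ => ⟨b.1, b.2, hb⟩, fun ⟨T, hT, h⟩ => ⟨⟨T, hT⟩, h⟩⟩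

/-- If the Taylor resolution is minimal, every minimal resolution has the same Betti numbers up to
vanishing. -/
lemma betti_ne_zero_iff {I : Ideal (MvPolynomial σ k)}
    (hI : I = Ideal.span (Set.range fun i => monomial (m i) (1 : k)))
    (hm : (resolution m hI).IsMinimal) {F : GradedFreeResolution I} (hF : F.IsMinimal)
    (i : ℕ) (j : ℤ) :
    F.betti i j ≠ 0 ↔ ∃ T : Finset (Fin q), T.card = i ∧ ((T.sup m).degree : ℤ) = j := by
  rw [← betti_resolution_ne_zero_iff m hI]
  refine hF.betti_ne_zero_iff hm (fun b => ?_) i j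
  -- The Taylor augmentation is the quotient map on the single basis element of degree `0`, so the
  -- representative `p` is itself the homogeneous lift.
  obtain ⟨p, hp, h⟩ := F.ε_homogeneous b
  refine ⟨Finsupp.single emptyFace p, fun c => ?_, (augmentation_single I _ p).trans h.symm⟩
  obtain rfl : c = emptyFace := eq_emptyFace c
  have hdeg : (resolution m hI).deg 0 emptyFace = 0 := by
    simp [resolution, emptyFace, bot_eq_zero]
  rw [hdeg, sub_zero]
  exact (Finsupp.single_eq_same (a := emptyFace) (b := p)).symm ▸ hp

end Taylor

/-! ### Dominance, lcm degrees and uniqueness of minimal generators. -/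

section Dominant

variable {σ : Type*} {q : ℕ} {m : Fin q → (σ →₀ ℕ)}

lemma degree_lt_degree_of_le {a b : σ →₀ ℕ} (hab : a ≤ b) {x : σ} (hx : a x < b x) :
    a.degree < b.degree := by
  refine (Finsupp.degree_mono hab).lt_of_ne fun h => hx.ne ?_
  have hd := congrArg Finsupp.degree (add_tsub_cancel_of_le hab)
  rw [map_add] at hd
  have h0 : b - a = 0 := (Finsupp.degree_eq_zero_iff _).1 (by omega)
  rw [hab.antisymm (tsub_eq_zero_iff_le.1 h0)]

/-- The exponent of the dominant variable of `m i` is a maximum of numbers below `e` in `lcm T`, and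
at least `e` once `i` is inserted. Positivity of `e` covers empty `T`. -/
lemma degree_sup_lt_degree_sup_insert
    (hm : ∀ i, ∃ x e, 0 < e ∧ e ≤ m i x ∧ ∀ j, j ≠ i → m j x < e)
    {i : Fin q} {T : Finset (Fin q)} (hi : i ∉ T) :
    (T.sup m).degree < ((insert i T).sup m).degree := by
  obtain ⟨x, e, he, hie, hlt⟩ := hm i
  have hx : T.sup m x < e :=
    Finset.sup_induction (p := fun f : σ →₀ ℕ => f x < e) (by simpa [bot_eq_zero] using he)
      (fun f hf g hg => max_lt hf hg) fun j hj => hlt j fun h => hi (h ▸ hj)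
  have hle : m i ≤ (insert i T).sup m := Finset.le_sup (Finset.mem_insert_self i T)
  exact degree_lt_degree_of_le (Finset.sup_mono (Finset.subset_insert i T))
    (hx.trans_le (hie.trans (hle x)))

lemma degree_sup_sub_card_mono
    (hm : ∀ i, ∃ x e, 0 < e ∧ e ≤ m i x ∧ ∀ j, j ≠ i → m j x < e) :
    Monotone fun T : Finset (Fin q) => ((T.sup m).degree : ℤ) - T.card := by
  refine Finset.monotone_iff_forall_le_insert.2 fun T i hi => ?_
  have := degree_sup_lt_degree_sup_insert hm hi
  rw [Finset.card_insert_of_notMem hi]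
  push_cast
  omega

lemma exists_le_of_monomialIdeal_le {k : Type*} [Field k] {G G' : Finset (σ →₀ ℕ)}
    (h : monomialIdeal k G ≤ monomialIdeal k G') {a : σ →₀ ℕ} (ha : a ∈ G) : ∃ b ∈ G', b ≤ a :=
  mem_ideal_span_monomial_image.1 (h (Ideal.subset_span ⟨a, ha, rfl⟩)) a (by classical simp [coeff_monomial])

/-- A generator properly divisible by another could be erased. -/
lemma IsMinimalGeneratingSet.eq_of_le {k : Type*} [Field k] {G : Finset (σ →₀ ℕ)}
    {M : Ideal (MvPolynomial σ k)} (hG : IsMinimalGeneratingSet G M) {a b : σ →₀ ℕ} (ha : a ∈ G)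
    (hb : b ∈ G) (hba : b ≤ a) : b = a := by
  classical
  by_contra hne
  have hgen : monomialIdeal k (G.erase a) = M := by
    rw [← hG.prop]
    refine le_antisymm (Ideal.span_mono (Set.image_mono (by simp))) (Ideal.span_le.2 ?_)
    rintro _ ⟨c, hc, rfl⟩
    refine mem_ideal_span_monomial_image.2 fun d hd => ?_
    rw [Finset.mem_singleton.1 (support_monomial_subset hd)]
    by_cases hca : c = a
    · exact ⟨b, by simp [hb, hne], hca ▸ hba⟩
    · exact ⟨c, Finset.mem_coe.2 (Finset.mem_erase.2 ⟨hca, hc⟩), le_rfl⟩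
  exact Finset.notMem_erase a G (hG.le_of_le hgen (Finset.erase_subset a G) ha)

/-- Dominance is known for some minimal generating set, while `h` and `q` are computed from a given
one; the two must be identified. -/
lemma IsMinimalGeneratingSet.unique {k : Type*} [Field k] {G G' : Finset (σ →₀ ℕ)}
    {M : Ideal (MvPolynomial σ k)} (hG : IsMinimalGeneratingSet G M)
    (hG' : IsMinimalGeneratingSet G' M) : G = G' := by
  have hsub : G ⊆ G' := fun a ha => by
    obtain ⟨b, hb, hba⟩ := exists_le_of_monomialIdeal_le (hG.prop.trans hG'.prop.symm).le ha
    obtain ⟨c, hc, hcb⟩ := exists_le_of_monomialIdeal_le (hG'.prop.trans hG.prop.symm).le hb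
    obtain rfl := hG.eq_of_le ha hc (hcb.trans hba)
    rwa [hcb.antisymm hba]
  exact hsub.antisymm (hG'.le_of_le hG.prop hsub)

end Dominant

end MonomialResolution

theorem theorem4p8 {k : Type*} {σ : Type*} [Field k] [Finite σ]
    (M : Ideal (MvPolynomial σ k)) (hM : MonomialResolution.IsDominantIdeal M)
    (G : Finset (σ →₀ ℕ)) (hG : MonomialResolution.IsMinimalGeneratingSet G M)
    (h q : ℕ) (hh : h = (G.sup id).degree) (hq : q = G.card) :
    MonomialResolution.HasRegularity M ((h : ℤ) - (q : ℤ)) := by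
  classical
  obtain ⟨G', hG', hdom⟩ := hM
  obtain rfl := hG.unique hG'
  subst hh hq
  let m : Fin G.card → (σ →₀ ℕ) := fun i => (G.equivFin.symm i).1
  have himage : Finset.univ.image m = G := by
    ext a
    simp only [Finset.mem_image, Finset.mem_univ, true_and]
    constructor
    · rintro ⟨i, rfl⟩
      exact (G.equivFin.symm i).2
    · intro ha
      exact ⟨G.equivFin ⟨a, ha⟩, by simp [m]⟩
  have hm : ∀ i, ∃ x e, 0 < e ∧ e ≤ m i x ∧ ∀ j, j ≠ i → m j x < e := by
    intro i
    obtain ⟨x, e, he, hle, hlt⟩ := hdom (m i) (G.equivFin.symm i).2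
    exact ⟨x, e, he, hle, fun j hj => not_le.1 <| hlt (m j) (G.equivFin.symm j).2
      fun h => hj (G.equivFin.symm.injective (Subtype.ext h))⟩
  have hsup : Finset.univ.sup m = G.sup id := by
    conv_rhs => rw [← himage, Finset.sup_image, Function.id_comp]
  have hI : M = Ideal.span (Set.range fun i => MvPolynomial.monomial (m i) (1 : k)) := by
    rw [← hG.prop, MonomialResolution.monomialIdeal]
    congr 1
    conv_lhs => rw [← himage, Finset.coe_image, Finset.coe_univ, Set.image_univ, ← Set.range_comp]
    rfl
  have hmin : (MonomialResolution.Taylor.resolution m hI).IsMinimal := by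
    refine MonomialResolution.Taylor.constantCoeff_differential k m fun T i hi h => ?_
    have := MonomialResolution.degree_sup_lt_degree_sup_insert hm (Finset.notMem_erase i T)
    rw [Finset.insert_erase hi, h] at this
    exact this.false
  refine ⟨⟨_, hmin⟩, fun F hF => ⟨?_, ?_⟩⟩
  -- The maximum is attained by the face containing all generators.
  · refine ⟨G.card, ((G.sup id).degree : ℤ), ?_, rfl⟩
    rw [MonomialResolution.Taylor.betti_ne_zero_iff m hI hmin hF]
    exact ⟨Finset.univ, by simp, by rw [hsup]⟩
  · rintro _ ⟨i, j, hij, rfl⟩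
    obtain ⟨T, rfl, rfl⟩ := (MonomialResolution.Taylor.betti_ne_zero_iff m hI hmin hF i j).1 hij
    have := MonomialResolution.degree_sup_sub_card_mono hm (Finset.subset_univ T)
    simpa [hsup] using this
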